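/- **Theorem.** For a bounded operator $T$ on a complex normed space $X$, put $\mathbb{C}\text{-}\mathrm{Orb}(T)=\{\lambda T^n:\lambda\in\mathbb{C},\,n\ge 0\}$ and, for $x\in X$, $\mathbb{C}\text{-}\mathrm{Orb}(T,x)=\{\lambda T^n x:\lambda\in\mathbb{C},\,n\ge 0\}$. Let $\mathbb{C}\text{-}\mathrm{OrbRef}(T)$ be the set of all bounded operators $S$ on $X$ such that $Sx$ lies in the norm closure of $\mathbb{C}\text{-}\mathrm{Orb}(T,x)$ for every $x\in X$. The operator $T$ is called *$\mathbb{C}$-orbit reflexive* if $\mathbb{C}\text{-}\mathrm{OrbRef}(T)$ is the closure of $\mathbb{C}\text{-}\mathrm{Orb}(T)$ in the strong operator topology. Let $T$ be a complex $d\times d$ matrix, regarded as an operator on the Euclidean space $\mathbb{C}^d$, and suppose that $T$ is not nilpotent. Let $r(T)=\max\{|\lambda|:\lambda\in\sigma(T)\}$ be its spectral radius. Then $r(T)>0$, $T$ has a Jordan form, and for every Jordan form of $T$ the following are equivalent: 1. $T$ is $\mathbb{C}$-orbit reflexive; 2. among all the Jordan blocks whose eigenvalue has modulus equal to $r(T)$,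 the two largest blocks differ in size by at most $1$. (Blocks are counted with multiplicity, so the two largest blocks may have the same size and may belong to the same eigenvalue or to different eigenvalues. If there is only one block with eigenvalue of modulus $r(T)$, the size of the missing second block is taken to be $0$, so that the condition says that this single block has size $1$.) -/

import Mathlib

noncomputable section

namespace COrbit

/-! ### Orbits and orbit reflexivity of an operator on a complex normed space -/

section Operators

variable {X : Type*} [NormedAddCommGroup X] [NormedSpace ℂ X]

/-- `ℂ-Orb(T) = {λ Tⁿ : n ≥ 0, λ ∈ ℂ}`, a set of bounded operators. -/
def orb (T : X →L[ℂ] X) : Set (X →L[ℂ] X) :=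
  {S | ∃ (c : ℂ) (n : ℕ), S = c • T ^ n}

/-- `ℂ-Orb(T, x) = {λ Tⁿ x : n ≥ 0, λ ∈ ℂ}`, a set of vectors. -/
def orbAt (T : X →L[ℂ] X) (x : X) : Set X :=
  {y | ∃ (c : ℂ) (n : ℕ), y = c • (T ^ n) x}

/-- `ℂ-OrbRef(T)`: the operators `S` such that `S x` lies in the (norm) closure of
`ℂ-Orb(T, x)` for every `x`. -/
def orbRef (T : X →L[ℂ] X) : Set (X →L[ℂ] X) :=
  {S | ∀ x : X, S x ∈ closure (orbAt T x)}

/-- The closure of a set of bounded operators in the strong operator topology, which is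
the topology of pointwise convergence carried by the type synonym `X →Lₚₜ[ℂ] X`. -/
def sotClosure (A : Set (X →L[ℂ] X)) : Set (X →L[ℂ] X) :=
  {S | ContinuousLinearMap.toPointwiseConvergenceCLM ℂ (RingHom.id ℂ) X X S ∈
    closure (ContinuousLinearMap.toPointwiseConvergenceCLM ℂ (RingHom.id ℂ) X X '' A)}

/-- `T` is `ℂ`-orbit reflexive: `ℂ-OrbRef(T)` is the strong operator closure of
`ℂ-Orb(T)`. -/
def IsOrbitReflexive (T : X →L[ℂ] X) : Prop :=
  orbRef T = sotClosure (orb T)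

end Operators

/-! ### Jordan forms of complex matrices -/

/-- The `m × m` Jordan block with eigenvalue `μ`: `μ` on the diagonal, `1` on the
subdiagonal and `0` elsewhere. -/
def jordanBlock (μ : ℂ) (m : ℕ) : Matrix (Fin m) (Fin m) ℂ :=
  Matrix.of fun i j =>
    if i = j then μ else if (i : ℕ) = (j : ℕ) + 1 then 1 else 0

/-- A finite list of Jordan blocks, each given by its eigenvalue and its size. -/
structure JordanBlocks where
  numBlocks : ℕ
  eigenvalue : Fin numBlocks → ℂ
  size : Fin numBlocks → ℕ
  size_pos : ∀ i, 0 < size i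

/-- The block diagonal matrix whose diagonal blocks are the given Jordan blocks. -/
def JordanBlocks.toMatrix (J : JordanBlocks) :
    Matrix (Σ i, Fin (J.size i)) (Σ i, Fin (J.size i)) ℂ :=
  Matrix.blockDiagonal' fun i => jordanBlock (J.eigenvalue i) (J.size i)

/-- `J` is a Jordan form of `T`: after numbering the index set of the block diagonal matrix
of `J` by `Fin d`, that matrix is similar to `T`. -/
def IsJordanForm {d : ℕ} (T : Matrix (Fin d) (Fin d) ℂ) (J : JordanBlocks) : Prop :=
  ∃ (e : Fin d ≃ Σ i, Fin (J.size i)) (P : GL (Fin d) ℂ),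
    T = (P : Matrix (Fin d) (Fin d) ℂ) * J.toMatrix.submatrix e e *
      ((P⁻¹ : GL (Fin d) ℂ) : Matrix (Fin d) (Fin d) ℂ)

open scoped Classical in
/-- The (indices of the) Jordan blocks whose eigenvalue has modulus `r`. -/
def JordanBlocks.ofModulus (J : JordanBlocks) (r : ENNReal) : Finset (Fin J.numBlocks) :=
  Finset.univ.filter fun i => ‖J.eigenvalue i‖ₑ = r

/-- Among the Jordan blocks with eigenvalues of modulus `r`, the two largest blocks differ in
size by at most `1`: for a block `i` of largest size, the largest size occurring among the
remaining blocks is at least `size i - 1`. The size of a missing second block is `0`, the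
supremum of the empty set. -/
def JordanBlocks.TwoLargestDifferByAtMostOne (J : JordanBlocks) (r : ENNReal) : Prop :=
  ∃ i ∈ J.ofModulus r, (∀ j ∈ J.ofModulus r, J.size j ≤ J.size i) ∧
    J.size i ≤ ((J.ofModulus r).erase i).sup J.size + 1

end COrbit

end

/-! ### Growth of binomial coefficients times powers. -/

open Filter Topology Asymptotics

namespace COrbit

/-! In Jordan coordinates, `T ^ n` acts on a block by the entries `n.choose q * μ ^ (n - q)`. If the
largest block of modulus `r` has size `p + 1`, then only the last coordinates of such blocks of size
`p + 1` reach order `n ^ p * r ^ n`, with leading term `n.choose p * μ ^ (n - p)` times the first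
coordinate.

Suppose the two largest sizes differ by at most one and `S ∈ orbRef T`. If some `n` makes `S x` and
`T ^ n x` dependent for all `x`, then `S` lies in the orbit (`mem_orb_of_parallel`). Otherwise Baire
gives a dense set of `x` at which `S x` is a limit of `c k • T ^ n k x` with `n k → ∞`. There only
dominant coordinates survive. The second block forces the dominant coordinate of `S z` in block `i`
to depend only on the first coordinate of `z` in that block: by comparing moduli if both blocks are
dominant, by `coord_eq_zero_of_smaller_block` if the second is one shorter. Hence the scalars and
exponents found at one `x` work for every vector (`mem_sotClosure_of_dominant`).

If the largest block exceeds every other by at least two, the rank-one operator from its second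
coordinate to its last basis vector is in `orbRef T`, but does not commute with `T`
(`not_isOrbitReflexive`). -/

/-- The comparison sequence `n ^ p * r ^ n`. -/
def growth (r : ℝ) (p : ℕ) (n : ℕ) : ℝ := (n : ℝ) ^ p * r ^ n

theorem growth_isLittleO {r : ℝ} {q p : ℕ} (h : q < p) :
    growth r q =o[atTop] growth r p := by
  have h1 : (fun n : ℕ => (n : ℝ) ^ q) =o[atTop] fun n : ℕ => (n : ℝ) ^ p :=
    (isLittleO_pow_pow_atTop_of_lt h).comp_tendsto tendsto_natCast_atTop_atTop
  exact h1.mul_isBigO (isBigO_refl _ _)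

theorem growth_isBigO {r : ℝ} {q p : ℕ} (h : q ≤ p) :
    growth r q =O[atTop] growth r p := by
  rcases h.eq_or_lt with rfl | h
  · exact isBigO_refl _ _
  · exact (growth_isLittleO h).isBigO

theorem choose_mul_pow_isTheta {r : ℝ} (hr : 0 < r) {μ : ℂ} (hμ : ‖μ‖ = r) (q : ℕ) :
    (fun n : ℕ => (n.choose q : ℂ) * μ ^ (n - q)) =Θ[atTop] growth r q := by
  have h1 : (fun n : ℕ => (n.choose q : ℂ)) =Θ[atTop] fun n : ℕ => (n : ℝ) ^ q := by
    refine IsTheta.trans ?_ (isTheta_choose q)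
    exact IsTheta.of_norm_eventuallyEq (Eventually.of_forall fun n => by simp)
  have h2 : (fun n : ℕ => μ ^ (n - q)) =Θ[atTop] fun n : ℕ => r ^ n := by
    have h3 : (fun n : ℕ => μ ^ (n - q)) =Θ[atTop] fun n : ℕ => (r ^ q)⁻¹ * r ^ n := by
      refine IsTheta.of_norm_eventuallyEq ?_
      filter_upwards [eventually_ge_atTop q] with n hn
      rw [norm_pow, hμ, pow_sub₀ _ hr.ne' hn, mul_comm]
    exact h3.trans (isTheta_rfl.const_mul_left (by positivity))
  exact h1.mul h2

/-- A radius `ρ` strictly between `‖μ‖` and `r` absorbs the polynomial factor, whatever `q` and `p`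
are. As `ρ > 0`, this also covers `μ = 0`. -/
theorem choose_mul_pow_isLittleO_of_lt {r : ℝ} {μ : ℂ} (hμ : ‖μ‖ < r) (q p : ℕ) :
    (fun n : ℕ => (n.choose q : ℂ) * μ ^ (n - q)) =o[atTop] growth r p := by
  obtain ⟨ρ, h1, h2⟩ := exists_between hμ
  have hρ : 0 < ρ := (norm_nonneg _).trans_lt h1
  have hr : 0 < r := hρ.trans h2
  have h3 : (fun n : ℕ => (n.choose q : ℂ) * μ ^ (n - q)) =O[atTop]
      fun n : ℕ => (n.choose q : ℂ) * (ρ : ℂ) ^ (n - q) := by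
    have : ‖μ‖ ≤ ‖(ρ : ℂ)‖ := by
      rw [Complex.norm_real, Real.norm_of_nonneg hρ.le]; exact h1.le
    refine IsBigO.of_bound 1 (Eventually.of_forall fun n => ?_)
    simp only [norm_mul, norm_pow, one_mul]
    gcongr
  have h4 := h3.trans (choose_mul_pow_isTheta hρ (μ := (ρ : ℂ))
    (by rw [Complex.norm_real, Real.norm_of_nonneg hρ.le]) q).isBigO
  have h5 : growth ρ q =o[atTop] fun n : ℕ => r ^ n :=
    isLittleO_pow_const_mul_const_pow_const_pow_of_norm_lt q
      (by rwa [Real.norm_of_nonneg hρ.le])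
  have h6 : (fun n : ℕ => r ^ n) =O[atTop] growth r p := by
    have : growth r 0 = fun n : ℕ => r ^ n := by funext n; simp [growth]
    rw [← this]
    exact growth_isBigO p.zero_le
  exact (h4.trans_isLittleO h5).trans_isBigO h6

theorem choose_mul_pow_isLittleO {r : ℝ} (hr : 0 < r) {μ : ℂ} (hμ : ‖μ‖ ≤ r) {q p : ℕ}
    (h : q < p ∨ ‖μ‖ < r) :
    (fun n : ℕ => (n.choose q : ℂ) * μ ^ (n - q)) =o[atTop] growth r p := by
  rcases hμ.lt_or_eq with hμ | hμ
  · exact choose_mul_pow_isLittleO_of_lt hμ q p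
  · have h : q < p := h.resolve_right hμ.not_lt
    exact (choose_mul_pow_isTheta hr hμ q).isBigO.trans_isLittleO (growth_isLittleO h)

theorem choose_mul_pow_isBigO {r : ℝ} (hr : 0 < r) {μ : ℂ} (hμ : ‖μ‖ ≤ r) {q p : ℕ}
    (h : q ≤ p) :
    (fun n : ℕ => (n.choose q : ℂ) * μ ^ (n - q)) =O[atTop] growth r p := by
  rcases hμ.lt_or_eq with hμ | hμ
  · exact (choose_mul_pow_isLittleO_of_lt hμ q p).isBigO
  · exact (choose_mul_pow_isTheta hr hμ q).isBigO.trans (growth_isBigO h)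

/-! ### Coordinates in a Jordan basis and their growth along an orbit. -/

section Coordinates

variable {V : Type*} [NormedAddCommGroup V] [NormedSpace ℂ V]
  {ι : Type*} [Finite ι] {s : ι → ℕ}

/-- The coordinate functional at position `k` of block `i`; it is `0` for `k` out of range. -/
noncomputable def coord (b : Module.Basis (Σ i, Fin (s i)) ℂ V) (i : ι) (k : ℕ) : V →L[ℂ] ℂ :=
  if h : k < s i then
    (ContinuousLinearMap.proj (R := ℂ) (φ := fun _ : Σ i, Fin (s i) => ℂ) ⟨i, ⟨k, h⟩⟩).comp
      (b.equivFunL : V →L[ℂ] ((Σ i, Fin (s i)) → ℂ))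
  else 0

variable (b : Module.Basis (Σ i, Fin (s i)) ℂ V)

theorem coord_apply {i : ι} {k : ℕ} (h : k < s i) (x : V) :
    coord b i k x = b.repr x ⟨i, ⟨k, h⟩⟩ := by
  simp [coord, h, Module.Basis.equivFunL]

theorem coord_of_le {i : ι} {k : ℕ} (h : s i ≤ k) : coord b i k = 0 := by
  simp [coord, h.not_gt]

theorem ext_coord {x y : V} (h : ∀ i k, k < s i → coord b i k x = coord b i k y) : x = y := by
  refine b.ext_elem fun ⟨i, k⟩ => ?_
  have := h i k k.2
  rwa [coord_apply b k.2, coord_apply b k.2] at this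

theorem tendsto_of_coord {α : Type*} {l : Filter α} {f : α → V} {y : V}
    (h : ∀ i k, k < s i → Tendsto (fun a => coord b i k (f a)) l (𝓝 (coord b i k y))) :
    Tendsto f l (𝓝 y) := by
  have h1 : Tendsto (fun a => b.equivFunL (f a)) l (𝓝 (b.equivFunL y)) := by
    rw [tendsto_pi_nhds]
    rintro ⟨i, k⟩
    have := h i k k.2
    simp only [coord_apply b k.2] at this
    simpa [Module.Basis.equivFunL] using this
  have h2 := (b.equivFunL.symm.continuous.tendsto _).comp h1
  simpa [Function.comp_def] using h2

/-- The basis vector at position `k` of block `i`. -/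
noncomputable def vec {i : ι} {k : ℕ} (h : k < s i) : V := b ⟨i, ⟨k, h⟩⟩

open scoped Classical in
theorem coord_vec {i j : ι} {k l : ℕ} (hk : k < s i) :
    coord b j l (vec b hk) = if j = i ∧ l = k then 1 else 0 := by
  by_cases hl : l < s j
  · rw [coord_apply b hl, vec, b.repr_self, Finsupp.single_apply]
    congr 1
    rw [Sigma.mk.injEq]
    apply propext
    constructor
    · rintro ⟨rfl, h⟩
      simpa [eq_comm] using h
    · rintro ⟨rfl, rfl⟩
      simp
  · rw [coord_of_le b (not_lt.1 hl), if_neg]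
    · rfl
    · rintro ⟨rfl, rfl⟩
      exact hl hk

theorem coord_vec_self {i : ι} {k : ℕ} (hk : k < s i) : coord b i k (vec b hk) = 1 := by
  simp [coord_vec]

theorem coord_vec_ne {i j : ι} {k l : ℕ} (hk : k < s i) (h : ¬ (j = i ∧ l = k)) :
    coord b j l (vec b hk) = 0 := by
  simp [coord_vec, h]

/-- `b` is a basis in which `T` has Jordan form with block sizes `s` and eigenvalues `μ`. -/
def IsJordanBasis (T : V →L[ℂ] V) (μ : ι → ℂ) (b : Module.Basis (Σ i, Fin (s i)) ℂ V) : Prop :=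
  ∀ x i k, k < s i →
    coord b i k (T x) = μ i * coord b i k x + if k = 0 then 0 else coord b i (k - 1) x

variable {b} {T : V →L[ℂ] V} {μ : ι → ℂ}

/-- Binomial expansion of (scalar + shift)ⁿ on one block; the induction step is Pascal's rule. -/
theorem IsJordanBasis.coord_pow (hT : IsJordanBasis T μ b) (x : V) (n : ℕ) {i : ι} {k : ℕ}
    (hk : k < s i) :
    coord b i k ((T ^ n) x) =
      ∑ q ∈ Finset.range (k + 1), (n.choose q : ℂ) * μ i ^ (n - q) * coord b i (k - q) x := by
  induction n generalizing k with
  | zero =>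
    rw [Finset.sum_eq_single 0]
    · simp
    · intro q _ hq
      rw [Nat.choose_eq_zero_of_lt (Nat.pos_of_ne_zero hq)]
      simp
    · simp
  | succ n ih =>
    rw [pow_succ', mul_apply_eq_comp, hT _ _ _ hk, ih hk]
    -- For `q > n` the truncated exponent is wrong, but the binomial coefficient is zero.
    have hmul : ∀ q, μ i * ((n.choose q : ℂ) * μ i ^ (n - q)) =
        (n.choose q : ℂ) * μ i ^ (n + 1 - q) := by
      intro q
      rcases lt_or_ge n q with h | h
      · simp [Nat.choose_eq_zero_of_lt h]
      · rw [Nat.succ_sub h, pow_succ]; ring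
    rcases k with _ | k
    · simp [pow_succ]; ring
    · have hk' : k < s i := by omega
      rw [if_neg (Nat.succ_ne_zero k), Nat.add_sub_cancel, ih hk', Finset.mul_sum,
        Finset.sum_range_succ' _ (k + 1), Finset.sum_range_succ' _ (k + 1)]
      rw [add_right_comm, ← Finset.sum_add_distrib]
      congr 1
      · refine Finset.sum_congr rfl fun q _ => ?_
        rw [← mul_assoc, hmul, Nat.choose_succ_succ, Nat.add_sub_add_right, Nat.add_sub_add_right]
        push_cast; ring
      · rw [← mul_assoc, hmul]; simp

theorem IsJordanBasis.coord_zero_pow (hT : IsJordanBasis T μ b) (x : V) (n : ℕ) {i : ι}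
    (hk : 0 < s i) : coord b i 0 ((T ^ n) x) = μ i ^ n * coord b i 0 x := by
  rw [hT.coord_pow x n hk]; simp

/-- Each of the `l` vanishing initial coordinates lowers the polynomial degree of the growth at
position `k` by one. -/
theorem IsJordanBasis.coord_pow_isLittleO (hT : IsJordanBasis T μ b) {r : ℝ} (hr : 0 < r)
    {x : V} {i : ι} (hμ : ‖μ i‖ ≤ r) {k l p : ℕ} (hk : k < s i)
    (hx : ∀ m < l, coord b i m x = 0) (h : k < p + l ∨ ‖μ i‖ < r) :
    (fun n => coord b i k ((T ^ n) x)) =o[atTop] growth r p := by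
  simp_rw [fun n => hT.coord_pow x n hk]
  refine IsLittleO.fun_sum fun q hq => ?_
  rw [Finset.mem_range] at hq
  by_cases hq' : k - q < l
  · simp [hx _ hq']
  · simp_rw [mul_comm _ (coord b i (k - q) x)]
    refine IsLittleO.const_mul_left (choose_mul_pow_isLittleO hr hμ ?_) _
    refine h.imp_left fun h => ?_
    omega

theorem IsJordanBasis.coord_pow_isBigO (hT : IsJordanBasis T μ b) {r : ℝ} (hr : 0 < r)
    {x : V} {i : ι} (hμ : ‖μ i‖ ≤ r) {k l p : ℕ} (hk : k < s i)
    (hx : ∀ m < l, coord b i m x = 0) (h : k ≤ p + l) :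
    (fun n => coord b i k ((T ^ n) x)) =O[atTop] growth r p := by
  simp_rw [fun n => hT.coord_pow x n hk]
  refine IsBigO.fun_sum fun q hq => ?_
  rw [Finset.mem_range] at hq
  by_cases hq' : k - q < l
  · simpa [hx _ hq'] using isBigO_zero _ _
  · simp_rw [mul_comm _ (coord b i (k - q) x)]
    refine IsBigO.const_mul_left (choose_mul_pow_isBigO hr hμ ?_) _
    omega

/-- In the expansion at position `p + l`, terms with `q > p` meet vanishing coordinates and terms
with `q < p` grow more slowly, so `q = p` is the leading term. -/
theorem IsJordanBasis.coord_pow_sub_isLittleO (hT : IsJordanBasis T μ b) {r : ℝ} (hr : 0 < r)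
    {x : V} {i : ι} (hμ : ‖μ i‖ ≤ r) {l p : ℕ} (hk : p + l < s i)
    (hx : ∀ m < l, coord b i m x = 0) :
    (fun n : ℕ => coord b i (p + l) ((T ^ n) x) -
      (n.choose p : ℂ) * μ i ^ (n - p) * coord b i l x) =o[atTop] growth r p := by
  have h1 : (fun n : ℕ => coord b i (p + l) ((T ^ n) x) -
      (n.choose p : ℂ) * μ i ^ (n - p) * coord b i l x) = fun n : ℕ =>
      ∑ q ∈ (Finset.range (p + l + 1)).erase p,
        (n.choose q : ℂ) * μ i ^ (n - q) * coord b i (p + l - q) x := by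
    funext n
    rw [hT.coord_pow x n hk, ← Finset.add_sum_erase (Finset.range (p + l + 1)) _
      (Finset.mem_range.2 (by omega : p < p + l + 1)), Nat.add_sub_cancel_left]
    ring
  rw [h1]
  refine IsLittleO.fun_sum fun q hq => ?_
  rw [Finset.mem_erase, Finset.mem_range] at hq
  by_cases hq' : p + l - q < l
  · simp [hx _ hq']
  · simp_rw [mul_comm _ (coord b i (p + l - q) x)]
    refine IsLittleO.const_mul_left (choose_mul_pow_isLittleO hr hμ ?_) _
    omega

theorem IsJordanBasis.coord_pow_isTheta (hT : IsJordanBasis T μ b) {r : ℝ} (hr : 0 < r)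
    {x : V} {i : ι} (hμ : ‖μ i‖ = r) {l p : ℕ} (hk : p + l < s i)
    (hx : ∀ m < l, coord b i m x = 0) (hl : coord b i l x ≠ 0) :
    (fun n : ℕ => coord b i (p + l) ((T ^ n) x)) =Θ[atTop] growth r p := by
  have h1 := hT.coord_pow_sub_isLittleO hr hμ.le hk hx
  have h2 : (fun n : ℕ => (n.choose p : ℂ) * μ i ^ (n - p) * coord b i l x)
      =Θ[atTop] growth r p := by
    simp_rw [mul_comm _ (coord b i l x)]
    exact (choose_mul_pow_isTheta hr hμ p).const_mul_left hl
  have h3 := h1.add_isTheta h2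
  exact (EventuallyEq.of_eq (by funext n; simp only [Pi.add_apply, sub_add_cancel])).trans_isTheta h3

end Coordinates

end COrbit

open Filter Topology Asymptotics

namespace COrbit

/-! ### Strong closures, local linear dependence and Baire category. -/

section Closure

variable {X : Type*} [NormedAddCommGroup X] [NormedSpace ℂ X] {T S : X →L[ℂ] X}

theorem mem_sotClosure_of_tendsto {c : ℕ → ℂ} {n : ℕ → ℕ}
    (h : ∀ x, Tendsto (fun k => c k • (T ^ n k) x) atTop (𝓝 (S x))) : S ∈ sotClosure (orb T) := by
  change ContinuousLinearMap.toPointwiseConvergenceCLM ℂ (RingHom.id ℂ) X X S ∈ closure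
    (ContinuousLinearMap.toPointwiseConvergenceCLM ℂ (RingHom.id ℂ) X X '' orb T)
  refine mem_closure_of_tendsto (b := atTop)
    (f := fun k => ContinuousLinearMap.toPointwiseConvergenceCLM ℂ (RingHom.id ℂ) X X
      (c k • T ^ n k)) ?_ (Eventually.of_forall fun k => Set.mem_image_of_mem _ ⟨c k, n k, rfl⟩)
  rw [PointwiseConvergenceCLM.tendsto_iff_forall_tendsto]
  exact h

theorem orb_subset_sotClosure : orb T ⊆ sotClosure (orb T) := by
  rintro _ ⟨c, n, rfl⟩
  exact mem_sotClosure_of_tendsto (c := fun _ => c) (n := fun _ => n) fun _ => tendsto_const_nhds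

theorem sotClosure_orb_subset_orbRef : sotClosure (orb T) ⊆ orbRef T := by
  intro S hS x
  refine map_mem_closure (f := fun A : X →Lₚₜ[ℂ] X => A x)
    (ContinuousEvalConst.continuous_eval_const x) hS ?_
  rintro _ ⟨_, ⟨c, n, rfl⟩, rfl⟩
  exact ⟨c, n, rfl⟩

/-- Commuting with `T` is a pointwise closed condition; this is the obstruction used against
reflexivity. -/
theorem apply_comm_of_mem_sotClosure (hS : S ∈ sotClosure (orb T)) (x : X) :
    S (T x) = T (S x) := by
  have hc : IsClosed {A : X →Lₚₜ[ℂ] X | A (T x) = T (A x)} :=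
    isClosed_eq (ContinuousEvalConst.continuous_eval_const (T x))
      (T.continuous.comp (ContinuousEvalConst.continuous_eval_const x))
  refine (closure_minimal ?_ hc) hS
  rintro _ ⟨_, ⟨c, n, rfl⟩, rfl⟩
  change c • (T ^ n) (T x) = T (c • (T ^ n) x)
  rw [map_smul, ← mul_apply_eq_comp, ← mul_apply_eq_comp, pow_mul_comm']

theorem apply_mem_of_mem_orbRef (hS : S ∈ orbRef T) {x : X} {C : Set X} (hC : IsClosed C)
    (h : ∀ (c : ℂ) (n : ℕ), c • (T ^ n) x ∈ C) : S x ∈ C := by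
  refine closure_minimal ?_ hC (hS x)
  rintro _ ⟨c, n, rfl⟩
  exact h c n

/-- Two vectors are parallel if they are linearly dependent. -/
def Parallel (u v : X) : Prop := ∀ f g : X →L[ℂ] ℂ, f u * g v = g u * f v

theorem Parallel.exists_smul {u v : X} (h : Parallel u v) (hv : v ≠ 0) : ∃ c : ℂ, u = c • v := by
  obtain ⟨f, hf⟩ := SeparatingDual.exists_ne_zero (R := ℂ) hv
  refine ⟨f u / f v, ?_⟩
  by_contra hne
  obtain ⟨g, hg⟩ := SeparatingDual.exists_separating_of_ne (R := ℂ) hne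
  apply hg
  rw [map_smul, smul_eq_mul, div_mul_eq_mul_div, eq_div_iff hf]
  exact (h f g).symm

theorem isClosed_parallel (S N : X →L[ℂ] X) : IsClosed {x | Parallel (S x) (N x)} := by
  simp only [Parallel, Set.ofPred_forall]
  refine isClosed_iInter fun f => isClosed_iInter fun g => isClosed_eq ?_ ?_ <;> fun_prop

theorem isClosed_parallel_const (v : X) : IsClosed {u | Parallel u v} := by
  simp only [Parallel, Set.ofPred_forall]
  refine isClosed_iInter fun f => isClosed_iInter fun g => isClosed_eq ?_ ?_ <;> fun_prop

/-- Dependence is a system of quadratic equations. The second difference at `x₀`, `x₀ + t x`, `x₀ -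
t x` isolates the `t ^ 2` coefficient, which is the equation at `x`. -/
theorem parallel_of_nonempty_interior {S N : X →L[ℂ] X}
    (h : (interior {x | Parallel (S x) (N x)}).Nonempty) (x : X) : Parallel (S x) (N x) := by
  obtain ⟨x₀, hx₀⟩ := h
  have hcont : ∀ a : ℝ, Tendsto (fun t : ℝ => x₀ + ((a * t : ℝ) : ℂ) • x) (𝓝 0) (𝓝 x₀) := by
    intro a
    have : Continuous (fun t : ℝ => x₀ + ((a * t : ℝ) : ℂ) • x) := by fun_prop
    simpa using this.tendsto 0
  have hmem := mem_interior_iff_mem_nhds.1 hx₀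
  have h1 := ((hcont 1).eventually hmem).and ((hcont (-1)).eventually hmem)
  obtain ⟨t, ⟨ht1, ht2⟩, ht0⟩ :=
    ((h1.filter_mono nhdsWithin_le_nhds).and (self_mem_nhdsWithin (s := {(0 : ℝ)}ᶜ))).exists
  have h0 : Parallel (S x₀) (N x₀) := interior_subset hx₀
  intro f g
  have e0 := h0 f g
  have e1 := ht1 f g
  have e2 := ht2 f g
  have ht : (t : ℂ) ^ 2 ≠ 0 := pow_ne_zero 2 (Complex.ofReal_ne_zero.2 ht0)
  simp only [map_add, map_smul, smul_eq_mul] at e1 e2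
  push_cast at e1 e2
  refine mul_left_cancel₀ ht ?_
  linear_combination (e1 + e2) / 2 - e0

/-- Polarizing the dependence against the eigenvector `x₀`, where `T ^ n x₀ ≠ 0`, confines the error
`S y - α • T ^ n y` to the line of `x₀`. A nonzero error puts `T ^ n y` on that line too, so `y` is
a multiple of `x₀` modulo the kernel of `T ^ n`, and there `S` agrees with `α • T ^ n`. -/
theorem mem_orb_of_parallel (hS : S ∈ orbRef T) {n : ℕ}
    (hpar : ∀ x, Parallel (S x) ((T ^ n) x)) {x₀ : X} (hx₀ : x₀ ≠ 0) {μ : ℂ} (hμ : μ ≠ 0)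
    (hTx₀ : T x₀ = μ • x₀) : S ∈ orb T := by
  have hpow : ∀ k : ℕ, (T ^ k) x₀ = μ ^ k • x₀ := by
    intro k
    induction k with
    | zero => simp
    | succ k ih => rw [pow_succ', mul_apply_eq_comp, ih, map_smul, hTx₀, smul_smul, pow_succ]
  have hμn : μ ^ n ≠ 0 := pow_ne_zero n hμ
  have hker : ∀ y, (T ^ n) y = 0 → S y = 0 := by
    intro y hy
    have h1 : Parallel (S y) x₀ := by
      intro f g
      have e1 := hpar (y + x₀) f g
      have e2 := hpar x₀ f g
      simp only [map_add, hy, zero_add, hpow, map_smul, smul_eq_mul] at e1 e2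
      refine mul_left_cancel₀ hμn ?_
      linear_combination e1 - e2
    obtain ⟨β, hβ⟩ := h1.exists_smul hx₀
    -- The kernel of `T ^ n` is closed and contains the orbit of `y`, but meets the line of `x₀`
    -- only in `0`.
    have h2 : (T ^ n) (S y) = 0 := by
      refine apply_mem_of_mem_orbRef hS (C := {z | (T ^ n) z = 0})
        (isClosed_eq (T ^ n).continuous continuous_const) fun c k => ?_
      change (T ^ n) (c • (T ^ k) y) = 0
      rw [map_smul, ← mul_apply_eq_comp, ← pow_add, add_comm, pow_add, mul_apply_eq_comp, hy,
        map_zero, smul_zero]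
    rw [hβ, map_smul, hpow, smul_smul, smul_eq_zero] at h2
    have h3 : β = 0 := by simpa [hμn, hx₀] using h2
    rw [hβ, h3, zero_smul]
  obtain ⟨α, hα⟩ : ∃ α : ℂ, S x₀ = α • (T ^ n) x₀ :=
    (hpar x₀).exists_smul (by rw [hpow]; exact smul_ne_zero hμn hx₀)
  refine ⟨α, n, ?_⟩
  ext y
  change S y = α • (T ^ n) y
  rw [← sub_eq_zero]
  have h1 : Parallel (S y - α • (T ^ n) y) x₀ := by
    intro f g
    have e1 := hpar y f g
    have e2 := hpar (y + x₀) f g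
    simp only [map_add, map_sub, hα, hpow, map_smul, smul_eq_mul] at e1 e2 ⊢
    refine mul_left_cancel₀ hμn ?_
    linear_combination e2 - e1
  obtain ⟨β, hβ⟩ := h1.exists_smul hx₀
  by_cases hβ0 : β = 0
  · rw [hβ, hβ0, zero_smul]
  have h2 : Parallel ((T ^ n) y) x₀ := by
    intro f g
    have e1 := hpar y f g
    have hSy : S y = α • (T ^ n) y + β • x₀ := by rw [← hβ]; abel
    simp only [hSy, map_add, map_smul, smul_eq_mul] at e1
    refine mul_left_cancel₀ hβ0 ?_
    linear_combination -e1
  obtain ⟨δ, hδ⟩ := h2.exists_smul hx₀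
  have h3 : (T ^ n) (y - (δ / μ ^ n) • x₀) = 0 := by
    rw [map_sub, map_smul, hδ, hpow, smul_smul, div_mul_cancel₀ _ hμn, sub_self]
  have h4 := hker _ h3
  rw [map_sub, sub_eq_zero, map_smul] at h4
  rw [map_sub, sub_eq_zero, map_smul] at h3
  rw [h4, h3, hα, smul_comm, sub_self]

/-- Baire: countably many closed sets with empty interior are avoided. -/
theorem dense_not_parallel [CompleteSpace X] (h : ∀ n, ¬ ∀ x, Parallel (S x) ((T ^ n) x))
    {κ : Type*} [Countable κ] {f : κ → X →L[ℂ] ℂ} (hf : ∀ i, f i ≠ 0) :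
    Dense {x | (∀ n, ¬ Parallel (S x) ((T ^ n) x)) ∧ ∀ i, f i x ≠ 0} := by
  have hA : ∀ n, IsOpen {x | Parallel (S x) ((T ^ n) x)}ᶜ ∧
      Dense {x | Parallel (S x) ((T ^ n) x)}ᶜ := fun n => by
    refine ⟨(isClosed_parallel S (T ^ n)).isOpen_compl, ?_⟩
    rw [← interior_eq_empty_iff_dense_compl, ← Set.not_nonempty_iff_eq_empty]
    exact fun hne => h n (parallel_of_nonempty_interior hne)
  have hB : ∀ i, IsOpen {x | f i x = 0}ᶜ ∧ Dense {x | f i x = 0}ᶜ := fun i => by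
    refine ⟨(isClosed_eq (f i).continuous continuous_const).isOpen_compl, ?_⟩
    rw [← interior_eq_empty_iff_dense_compl, ← Set.not_nonempty_iff_eq_empty]
    intro hne
    have h1 : (f i : X →ₗ[ℂ] ℂ).ker = ⊤ := by
      refine Submodule.eq_top_of_nonempty_interior' _ ?_
      exact hne
    apply hf i
    ext x
    have : x ∈ (f i : X →ₗ[ℂ] ℂ).ker := h1 ▸ Submodule.mem_top
    exact this
  have h2 := dense_iInter_of_isOpen
    (f := Sum.elim (fun n => {x | Parallel (S x) ((T ^ n) x)}ᶜ) (fun i => {x | f i x = 0}ᶜ))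
    (by rintro (n | i); exacts [(hA n).1, (hB i).1])
    (by rintro (n | i); exacts [(hA n).2, (hB i).2])
  refine h2.mono fun x hx => ?_
  rw [Set.mem_iInter] at hx
  exact ⟨fun n => hx (Sum.inl n), fun i => hx (Sum.inr i)⟩

/-- Dependence on a fixed `T ^ m x` is closed and fails at the limit, so each exponent `m` is
eventually avoided. -/
theorem exists_tendsto_of_mem_closure_orbAt {x y : X} (hy : y ∈ closure (orbAt T x))
    (hpar : ∀ n, ¬ Parallel y ((T ^ n) x)) :
    ∃ (c : ℕ → ℂ) (n : ℕ → ℕ), Tendsto n atTop atTop ∧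
      Tendsto (fun k => c k • (T ^ n k) x) atTop (𝓝 y) := by
  obtain ⟨u, hu, hlim⟩ := mem_closure_iff_seq_limit.1 hy
  choose c n hcn using hu
  obtain rfl : u = fun k => c k • (T ^ n k) x := funext hcn
  refine ⟨c, n, ?_, hlim⟩
  rw [← Nat.cofinite_eq_atTop]
  nth_rw 1 [Nat.cofinite_eq_atTop]
  refine le_cofinite_iff_eventually_ne.2 fun m => ?_
  rw [eventually_map]
  filter_upwards [hlim.eventually ((isClosed_parallel_const ((T ^ m) x)).isOpen_compl.mem_nhds
    (hpar m))] with k hk hkm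
  apply hk
  intro f g
  simp only [hkm, map_smul, smul_eq_mul]
  ring

end Closure

end COrbit

open Filter Topology Asymptotics

namespace COrbit

/-! ### Limits along dominant coordinates, and the sufficiency of the size condition. -/

section Dominant

variable {V : Type*} [NormedAddCommGroup V] [NormedSpace ℂ V]
  {ι : Type*} [Finite ι] {s : ι → ℕ} {b : Module.Basis (Σ i, Fin (s i)) ℂ V}
  {T S : V →L[ℂ] V} {μ : ι → ℂ} {r : ℝ} {p : ℕ} {c : ℕ → ℂ} {n : ℕ → ℕ} {x y : V}

theorem tendsto_mul_comp_zero (hn : Tendsto n atTop atTop)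
    (hc : (fun k => ‖c k‖ * growth r p (n k)) =O[atTop] fun _ => (1 : ℝ)) {f : ℕ → ℂ}
    (hf : f =o[atTop] growth r p) : Tendsto (fun k => c k * f (n k)) atTop (𝓝 0) := by
  have h1 : (fun k => f (n k)) =o[atTop] fun k => growth r p (n k) := hf.comp_tendsto hn
  have h2 : c =O[atTop] fun k => ‖c k‖ := (isBigO_refl c atTop).norm_right
  exact (isLittleO_one_iff ℝ).1 ((h2.mul_isLittleO h1).trans_isBigO hc)

theorem IsJordanBasis.coord_pow_isLittleO_of_not_dominant (hT : IsJordanBasis T μ b) (hr : 0 < r)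
    (hμ : ∀ i, ‖μ i‖ ≤ r) (hp : ∀ i, ‖μ i‖ = r → s i ≤ p + 1) {i : ι} {k : ℕ} (hk : k < s i)
    (h : ¬ (‖μ i‖ = r ∧ k = p)) (x : V) :
    (fun n => coord b i k ((T ^ n) x)) =o[atTop] growth r p := by
  refine hT.coord_pow_isLittleO hr (hμ i) hk (l := 0) (by simp) ?_
  rcases (hμ i).lt_or_eq with h' | h'
  · exact Or.inr h'
  · have := hp i h'
    have h2 : k ≠ p := fun h3 => h ⟨h', h3⟩
    exact Or.inl (by omega)

theorem IsJordanBasis.scalar_isBigO (hT : IsJordanBasis T μ b) (hr : 0 < r)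
    (hn : Tendsto n atTop atTop) (hlim : Tendsto (fun k => c k • (T ^ n k) x) atTop (𝓝 y))
    {i : ι} (hi : ‖μ i‖ = r) (hk : p < s i) (hx : coord b i 0 x ≠ 0) :
    (fun k => ‖c k‖ * growth r p (n k)) =O[atTop] fun _ => (1 : ℝ) := by
  have h1 : (fun k => growth r p (n k)) =O[atTop] fun k => coord b i p ((T ^ n k) x) :=
    (hT.coord_pow_isTheta hr hi (l := 0) hk (by simp) hx).isBigO_symm.comp_tendsto hn
  have h2 : (fun k => ‖c k‖) =O[atTop] c := (isBigO_refl c atTop).norm_left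
  have h3 : Tendsto (fun k => c k * coord b i p ((T ^ n k) x)) atTop (𝓝 (coord b i p y)) := by
    simpa only [Function.comp_def, map_smul, smul_eq_mul] using
      ((coord b i p).continuous.tendsto y).comp hlim
  exact (h2.mul h1).trans (h3.isBigO_one ℝ)

theorem IsJordanBasis.coord_limit_eq_zero (hT : IsJordanBasis T μ b) (hr : 0 < r)
    (hμ : ∀ i, ‖μ i‖ ≤ r) (hp : ∀ i, ‖μ i‖ = r → s i ≤ p + 1)
    (hn : Tendsto n atTop atTop) (hlim : Tendsto (fun k => c k • (T ^ n k) x) atTop (𝓝 y))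
    (hc : (fun k => ‖c k‖ * growth r p (n k)) =O[atTop] fun _ => (1 : ℝ))
    {i : ι} {k : ℕ} (hk : k < s i) (h : ¬ (‖μ i‖ = r ∧ k = p)) : coord b i k y = 0 := by
  have h1 := tendsto_mul_comp_zero hn hc
    (hT.coord_pow_isLittleO_of_not_dominant hr hμ hp hk h x)
  refine tendsto_nhds_unique ?_ h1
  simpa only [Function.comp_def, map_smul, smul_eq_mul] using
    ((coord b i k).continuous.tendsto y).comp hlim

theorem IsJordanBasis.tendsto_dominant_sub (hT : IsJordanBasis T μ b) (hr : 0 < r)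
    (hn : Tendsto n atTop atTop)
    (hc : (fun k => ‖c k‖ * growth r p (n k)) =O[atTop] fun _ => (1 : ℝ))
    {i : ι} (hi : ‖μ i‖ = r) (hk : p < s i) (x : V) :
    Tendsto (fun k => coord b i p (c k • (T ^ n k) x) -
      c k * (((n k).choose p : ℂ) * μ i ^ (n k - p)) * coord b i 0 x) atTop (𝓝 0) := by
  have h1 := tendsto_mul_comp_zero hn hc
    (hT.coord_pow_sub_isLittleO hr hi.le (x := x) (l := 0) hk (by simp))
  refine h1.congr fun k => ?_
  rw [map_smul, smul_eq_mul, add_zero]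
  ring

theorem IsJordanBasis.tendsto_dominant (hT : IsJordanBasis T μ b) (hr : 0 < r)
    (hn : Tendsto n atTop atTop) (hlim : Tendsto (fun k => c k • (T ^ n k) x) atTop (𝓝 y))
    (hc : (fun k => ‖c k‖ * growth r p (n k)) =O[atTop] fun _ => (1 : ℝ))
    {i : ι} (hi : ‖μ i‖ = r) (hk : p < s i) :
    Tendsto (fun k => c k * (((n k).choose p : ℂ) * μ i ^ (n k - p)) * coord b i 0 x) atTop
      (𝓝 (coord b i p y)) := by
  have h1 := (((coord b i p).continuous.tendsto y).comp hlim).sub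
    (hT.tendsto_dominant_sub hr hn hc hi hk x)
  simpa [Function.comp_def] using h1

/-- The leading factors of two dominant blocks differ only by phases, so they cancel in modulus. -/
theorem IsJordanBasis.norm_coord_limit (hT : IsJordanBasis T μ b) (hr : 0 < r)
    (hn : Tendsto n atTop atTop) (hlim : Tendsto (fun k => c k • (T ^ n k) x) atTop (𝓝 y))
    (hc : (fun k => ‖c k‖ * growth r p (n k)) =O[atTop] fun _ => (1 : ℝ))
    {i j : ι} (hi : ‖μ i‖ = r) (hki : p < s i) (hj : ‖μ j‖ = r) (hkj : p < s j) :
    ‖coord b i p y‖ * ‖coord b j 0 x‖ = ‖coord b j p y‖ * ‖coord b i 0 x‖ := by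
  have h1 := (hT.tendsto_dominant hr hn hlim hc hi hki).norm.mul_const ‖coord b j 0 x‖
  have h2 := (hT.tendsto_dominant hr hn hlim hc hj hkj).norm.mul_const ‖coord b i 0 x‖
  refine tendsto_nhds_unique h1 (h2.congr fun k => ?_)
  simp only [norm_mul, norm_pow, hi, hj]
  ring

/-- By `hS'`, each dominant coordinate of `S z` is that of `S x` times a ratio of first coordinates.
The leading terms of the orbits scale by the same ratio, so convergence at `x` transfers to `z`. -/
theorem IsJordanBasis.mem_sotClosure_of_dominant (hT : IsJordanBasis T μ b) (hr : 0 < r)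
    (hμ : ∀ i, ‖μ i‖ ≤ r) (hp : ∀ i, ‖μ i‖ = r → s i ≤ p + 1)
    (hn : Tendsto n atTop atTop) (hlim : Tendsto (fun k => c k • (T ^ n k) x) atTop (𝓝 (S x)))
    (hc : (fun k => ‖c k‖ * growth r p (n k)) =O[atTop] fun _ => (1 : ℝ))
    (hx : ∀ i, coord b i 0 x ≠ 0)
    (hS : ∀ i k, k < s i → ¬ (‖μ i‖ = r ∧ k = p) → ∀ z, coord b i k (S z) = 0)
    (hS' : ∀ i, ‖μ i‖ = r → p < s i → ∀ z, coord b i 0 z = 0 → coord b i p (S z) = 0) :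
    S ∈ sotClosure (orb T) := by
  refine mem_sotClosure_of_tendsto (c := c) (n := n) fun z => tendsto_of_coord b fun i k hk => ?_
  by_cases h : ‖μ i‖ = r ∧ k = p
  · obtain ⟨hi, rfl⟩ := h
    have hxi := hx i
    have h1 := ((hT.tendsto_dominant hr hn hlim hc hi hk).mul_const
      (coord b i 0 z / coord b i 0 x)).add (hT.tendsto_dominant_sub hr hn hc hi hk z)
    have h2 := hS' i hi hk (z - (coord b i 0 z / coord b i 0 x) • x) (by
      rw [map_sub, map_smul, smul_eq_mul, div_mul_cancel₀ _ hxi, sub_self])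
    rw [map_sub, map_sub, sub_eq_zero, map_smul, map_smul, smul_eq_mul] at h2
    rw [h2]
    rw [add_zero, mul_comm (coord b i k (S x))] at h1
    refine h1.congr fun m => ?_
    field_simp
    ring
  · rw [hS i k hk h z]
    simpa only [map_smul, smul_eq_mul] using tendsto_mul_comp_zero hn hc
      (hT.coord_pow_isLittleO_of_not_dominant hr hμ hp hk h z)

/-- Since `z` starts with `0` in block `i`, its coordinate at `p + 1` there grows no faster than the
one at `p` in block `j`. This inequality is closed and scale-invariant, hence holds at `S z`, where
the block `j` side vanishes. -/
theorem IsJordanBasis.coord_eq_zero_of_smaller_block (hT : IsJordanBasis T μ b) (hr : 0 < r)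
    (hS : S ∈ orbRef T) {i j : ι} (hi : ‖μ i‖ = r) (hki : p + 1 < s i) (hj : ‖μ j‖ = r)
    (hkj : p < s j) (hSj : ∀ k, k < s j → ∀ z, coord b j k (S z) = 0) {z : V}
    (hz : coord b i 0 z = 0) (hzj : coord b j 0 z ≠ 0) : coord b i (p + 1) (S z) = 0 := by
  have h1 : (fun n => coord b i (p + 1) ((T ^ n) z)) =O[atTop] growth r p :=
    hT.coord_pow_isBigO hr hi.le hki (l := 1) (by simpa using hz) le_rfl
  have h2 : growth r p =O[atTop] fun n => coord b j p ((T ^ n) z) :=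
    (hT.coord_pow_isTheta hr hj (l := 0) hkj (by simp) hzj).isBigO_symm
  -- The extra summand is nonzero for every `n`, which turns the asymptotic bound into one valid on
  -- the whole orbit.
  have h3 : (fun n => coord b i (p + 1) ((T ^ n) z)) =O[atTop]
      fun n => ‖coord b j p ((T ^ n) z)‖ + ‖coord b j 0 ((T ^ n) z)‖ := by
    refine (h1.trans h2).trans (IsBigO.of_bound 1 (Eventually.of_forall fun n => ?_))
    rw [Real.norm_of_nonneg (by positivity)]
    linarith [norm_nonneg (coord b j 0 ((T ^ n) z))]
  rw [isBigO_nat_atTop_iff] at h3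
  · obtain ⟨K, hK⟩ := h3
    have h4 := apply_mem_of_mem_orbRef hS (x := z) (C := {w | ‖coord b i (p + 1) w‖ ≤
      K * (‖coord b j p w‖ + ‖coord b j 0 w‖)}) (isClosed_le (by fun_prop) (by fun_prop)) (by
        intro a n
        have := hK n
        rw [Real.norm_of_nonneg (by positivity)] at this
        simp only [Set.mem_ofPred_eq, map_smul, smul_eq_mul, norm_mul]
        nlinarith [norm_nonneg a])
    simp only [Set.mem_ofPred_eq, hSj p hkj, hSj 0 (by omega), norm_zero, add_zero, mul_zero,
      norm_le_zero_iff] at h4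
    exact h4
  · intro n h
    exfalso
    have h5 : 0 < ‖coord b j 0 ((T ^ n) z)‖ := by
      rw [hT.coord_zero_pow z n (by omega), norm_pos_iff]
      exact mul_ne_zero (pow_ne_zero n (by rw [← norm_pos_iff, hj]; exact hr)) hzj
    linarith [norm_nonneg (coord b j p ((T ^ n) z))]

theorem IsJordanBasis.apply_vec_last (hT : IsJordanBasis T μ b) {i : ι} (h : p < s i)
    (hp : s i = p + 1) : T (vec b h) = μ i • vec b h := by
  refine ext_coord b fun j k hk => ?_
  rw [hT _ _ _ hk, map_smul, smul_eq_mul]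
  by_cases hji : j = i
  · subst hji
    have : k - 1 ≠ p ∨ k = 0 := by omega
    rcases this with h1 | h1
    · rw [coord_vec_ne b h (l := k - 1) (by simp [h1])]; simp
    · simp [h1]
  · rw [coord_vec_ne b h (l := k - 1) (by simp [hji]), coord_vec_ne b h (by simp [hji])]
    simp

theorem IsJordanBasis.mem_sotClosure_of_mem_orbRef [CompleteSpace V] (hT : IsJordanBasis T μ b)
    (hr : 0 < r) (hμ : ∀ i, ‖μ i‖ ≤ r) (hp : ∀ i, ‖μ i‖ = r → s i ≤ p + 1) (hs : ∀ i, 0 < s i)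
    {i₀ : ι} (h₀ : ‖μ i₀‖ = r) (hs₀ : s i₀ = p + 1)
    (hsecond : p = 0 ∨ ∃ j ≠ i₀, ‖μ j‖ = r ∧ p ≤ s j) (hS : S ∈ orbRef T) :
    S ∈ sotClosure (orb T) := by
  have hk₀ : p < s i₀ := by omega
  by_cases hpar : ∃ n, ∀ x, Parallel (S x) ((T ^ n) x)
  · obtain ⟨n, hn⟩ := hpar
    refine orb_subset_sotClosure (mem_orb_of_parallel hS hn (x₀ := vec b hk₀) (b.ne_zero _) ?_
      (hT.apply_vec_last hk₀ hs₀))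
    rw [← norm_pos_iff, h₀]
    exact hr
  push Not at hpar
  have hdense := dense_not_parallel (S := S) (T := T) (f := fun i => coord b i 0)
    (fun n h => (hpar n).elim fun x hx => hx (h x)) (fun i h => by
      have := coord_vec_self b (hs i)
      rw [h] at this
      simp at this)
  have hgen : ∀ x, ((∀ n, ¬ Parallel (S x) ((T ^ n) x)) ∧ ∀ i, coord b i 0 x ≠ 0) →
      ∃ (c : ℕ → ℂ) (n : ℕ → ℕ), Tendsto n atTop atTop ∧
        Tendsto (fun k => c k • (T ^ n k) x) atTop (𝓝 (S x)) ∧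
        (fun k => ‖c k‖ * growth r p (n k)) =O[atTop] fun _ => (1 : ℝ) := by
    rintro x ⟨hx1, hx2⟩
    obtain ⟨c, n, hn, hlim⟩ := exists_tendsto_of_mem_closure_orbAt (hS x) hx1
    exact ⟨c, n, hn, hlim, hT.scalar_isBigO hr hn hlim h₀ hk₀ (hx2 i₀)⟩
  have hzero : ∀ i k, k < s i → ¬ (‖μ i‖ = r ∧ k = p) → ∀ z, coord b i k (S z) = 0 := by
    intro i k hk h z
    refine hdense.induction (P := fun z => coord b i k (S z) = 0) (fun x hx => ?_)
      (isClosed_eq (by fun_prop) continuous_const) z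
    obtain ⟨c, n, hn, hlim, hc⟩ := hgen x hx
    exact hT.coord_limit_eq_zero hr hμ hp hn hlim hc hk h
  have hnorm : ∀ i j, ‖μ i‖ = r → p < s i → ‖μ j‖ = r → p < s j → ∀ z,
      ‖coord b i p (S z)‖ * ‖coord b j 0 z‖ = ‖coord b j p (S z)‖ * ‖coord b i 0 z‖ := by
    intro i j hi hki hj hkj z
    refine hdense.induction (P := fun z => ‖coord b i p (S z)‖ * ‖coord b j 0 z‖ =
      ‖coord b j p (S z)‖ * ‖coord b i 0 z‖) (fun x hx => ?_)
      (isClosed_eq (by fun_prop) (by fun_prop)) z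
    obtain ⟨c, n, hn, hlim, hc⟩ := hgen x hx
    exact hT.norm_coord_limit hr hn hlim hc hi hki hj hkj
  have htop : ∀ i, ‖μ i‖ = r → p < s i → ∀ z, coord b i 0 z = 0 → coord b i p (S z) = 0 := by
    intro i hi hki z
    -- Any dominant block other than `i₀` can use `i₀` itself as its companion.
    have hcase : p = 0 ∨ ∃ j ≠ i, ‖μ j‖ = r ∧ p ≤ s j := by
      refine hsecond.imp_right fun h => ?_
      by_cases hii : i = i₀
      · exact hii ▸ h
      · exact ⟨i₀, Ne.symm hii, h₀, hk₀.le⟩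
    rcases hcase with rfl | ⟨j, hji, hj, hpj⟩
    · intro hz
      refine apply_mem_of_mem_orbRef hS (C := {w | coord b i 0 w = 0})
        (isClosed_eq (by fun_prop) continuous_const) fun c n => ?_
      simp only [Set.mem_ofPred_eq, map_smul, hT.coord_zero_pow z n hki, hz, mul_zero, smul_zero]
    · -- the vector `z` may be assumed to have a component at the start of block `j`
      have hmain : ∀ z, coord b j 0 z ≠ 0 → coord b i 0 z = 0 → coord b i p (S z) = 0 := by
        intro z hzj hz
        rcases hpj.lt_or_eq with hpj | hpj
        · have := hnorm i j hi hki hj hpj z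
          rw [hz, norm_zero, mul_zero, mul_eq_zero, norm_eq_zero, norm_eq_zero] at this
          exact this.resolve_right hzj
        -- Block `j` has exactly `p` positions, none of them dominant, so `S` vanishes on all its
        -- coordinates.
        · obtain ⟨q, rfl⟩ : ∃ q, p = q + 1 := ⟨p - 1, by have := hs j; omega⟩
          refine hT.coord_eq_zero_of_smaller_block hr hS hi hki hj (by omega) ?_ hz hzj
          intro k hk w
          exact hzero j k hk (by omega) w
      intro hz
      have he := coord_vec_self b (hs j)
      have hei := coord_vec_ne b (hs j) (j := i) (l := 0) (by simp [Ne.symm hji])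
      by_cases hzj : coord b j 0 z = 0
      · have h1 := hmain (z + vec b (hs j)) (by simp [hzj, he]) (by simp [hz, hei])
        have h2 := hmain (vec b (hs j)) (by simp [he]) hei
        simpa [h2] using h1
      · exact hmain z hzj hz
  have : Nonempty V := ⟨0⟩
  obtain ⟨x, hx⟩ := hdense.nonempty
  obtain ⟨c, n, hn, hlim, hc⟩ := hgen x hx
  exact hT.mem_sotClosure_of_dominant hr hμ hp hn hlim hc hx.2 hzero htop

end Dominant

end COrbit

open Filter Topology Asymptotics

namespace COrbit

/-! ### A single block that is too large: the counterexample. -/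

section LargestBlock

variable {V : Type*} [NormedAddCommGroup V] [NormedSpace ℂ V]
  {ι : Type*} [Finite ι] {s : ι → ℕ} {b : Module.Basis (Σ i, Fin (s i)) ℂ V}
  {T : V →L[ℂ] V} {μ : ι → ℂ} {r : ℝ} {p : ℕ}

/-- After `l` zeros the last coordinate of block `i₀` still has order `n ^ q * r ^ n`; blocks of
modulus `r` and size at most `q` stay below that order. -/
theorem IsJordanBasis.tendsto_vec_last (hT : IsJordanBasis T μ b) (hr : 0 < r)
    (hμ : ∀ i, ‖μ i‖ ≤ r) {i₀ : ι} (h₀ : ‖μ i₀‖ = r) {q l : ℕ} (hs₀ : s i₀ = q + l + 1)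
    (hothers : ∀ j ≠ i₀, ‖μ j‖ = r → s j ≤ q) {x : V} (hx : ∀ m < l, coord b i₀ m x = 0)
    (hl : coord b i₀ l x ≠ 0) (hk₀ : q + l < s i₀) :
    Tendsto (fun n : ℕ => ((n.choose q : ℂ) * μ i₀ ^ (n - q) * coord b i₀ l x)⁻¹ • (T ^ n) x)
      atTop (𝓝 (vec b hk₀)) := by
  have hμ₀ : μ i₀ ≠ 0 := by rw [← norm_pos_iff, h₀]; exact hr
  have hO : growth r q =O[atTop]
      fun n : ℕ => (n.choose q : ℂ) * μ i₀ ^ (n - q) * coord b i₀ l x := by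
    simp_rw [mul_comm _ (coord b i₀ l x)]
    exact ((choose_mul_pow_isTheta hr h₀ q).const_mul_left hl).isBigO_symm
  refine tendsto_of_coord b fun j k hk => ?_
  simp only [map_smul, smul_eq_mul]
  by_cases hjk : j = i₀ ∧ k = q + l
  · obtain ⟨rfl, rfl⟩ := hjk
    rw [coord_vec_self]
    have h1 := ((hT.coord_pow_sub_isLittleO hr h₀.le hk hx).trans_isBigO
      hO).tendsto_div_nhds_zero.add_const 1
    rw [zero_add] at h1
    refine h1.congr' ?_
    filter_upwards [eventually_ge_atTop q] with n hn
    have hc : (n.choose q : ℂ) ≠ 0 := Nat.cast_ne_zero.2 (Nat.choose_pos hn).ne'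
    field_simp
    ring
  · rw [coord_vec_ne b hk₀ hjk]
    have h1 : (fun n => coord b j k ((T ^ n) x)) =o[atTop] growth r q := by
      by_cases hj : j = i₀
      · subst hj
        have : k ≠ q + l := fun h => hjk ⟨rfl, h⟩
        exact hT.coord_pow_isLittleO hr h₀.le hk hx (Or.inl (by omega))
      · refine hT.coord_pow_isLittleO hr (hμ j) hk (l := 0) (by simp) ?_
        rcases (hμ j).lt_or_eq with h | h
        · exact Or.inr h
        · have := hothers j hj h
          exact Or.inl (by omega)
    refine (h1.trans_isBigO hO).tendsto_div_nhds_zero.congr fun n => ?_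
    rw [div_eq_mul_inv, mul_comm]

theorem IsJordanBasis.not_isOrbitReflexive (hT : IsJordanBasis T μ b) (hr : 0 < r)
    (hμ : ∀ i, ‖μ i‖ ≤ r) {i₀ : ι} (h₀ : ‖μ i₀‖ = r) (hs₀ : s i₀ = p + 2)
    (hothers : ∀ j ≠ i₀, ‖μ j‖ = r → s j ≤ p) : ¬ IsOrbitReflexive T := by
  have hlast : p + 1 < s i₀ := by omega
  have hfirst : 0 < s i₀ := by omega
  intro href
  -- The normalized orbit tends to the last vector if coordinate `0` or `1` of `x` is nonzero. The
  -- case `l = 1` is where the gap of two is needed.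
  have hS : (coord b i₀ 1).smulRight (vec b hlast) ∈ orbRef T := by
    intro x
    rw [ContinuousLinearMap.smulRight_apply]
    have key : ∀ {q l : ℕ}, q + l = p + 1 → l ≤ 1 → (∀ m < l, coord b i₀ m x = 0) →
        coord b i₀ l x ≠ 0 → coord b i₀ 1 x • vec b hlast ∈ closure (orbAt T x) := by
      intro q l hql hl hx hlx
      have hk₀ : q + l < s i₀ := by omega
      have h1 := (hT.tendsto_vec_last hr hμ h₀ (q := q) (l := l) (by omega)
        (fun j hj h => (hothers j hj h).trans (by omega)) hx hlx hk₀).const_smul (coord b i₀ 1 x)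
      simp only [hql] at h1
      refine mem_closure_of_tendsto h1 (Eventually.of_forall fun n => ?_)
      exact ⟨_, n, smul_smul _ _ _⟩
    by_cases h0 : coord b i₀ 0 x = 0
    · by_cases h1 : coord b i₀ 1 x = 0
      · rw [h1, zero_smul]
        exact subset_closure ⟨0, 0, by simp⟩
      · exact key (q := p) (l := 1) rfl le_rfl (by simpa using h0) h1
    · exact key (q := p + 1) (l := 0) rfl zero_le_one (by simp) h0
  rw [href] at hS
  -- The operator kills the first basis vector, but sends its image under `T` to the last one.
  have h1 := apply_comm_of_mem_sotClosure hS (vec b hfirst)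
  rw [ContinuousLinearMap.smulRight_apply, ContinuousLinearMap.smulRight_apply,
    coord_vec_ne b hfirst (by simp), hT _ _ _ (by omega : 1 < s i₀),
    coord_vec_ne b hfirst (by simp), if_neg one_ne_zero, coord_vec_self, mul_zero, zero_add,
    one_smul, zero_smul, map_zero] at h1
  exact b.ne_zero _ h1

end LargestBlock

/-! ### The equivalence in terms of block sizes. -/

section Equivalence

variable {V : Type*} [NormedAddCommGroup V] [NormedSpace ℂ V] [CompleteSpace V]
  {T : V →L[ℂ] V} {r : ℝ} (J : JordanBlocks)
  {b : Module.Basis (Σ i, Fin (J.size i)) ℂ V}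

theorem JordanBlocks.mem_ofModulus_ofReal (hr : 0 ≤ r) (i : Fin J.numBlocks) :
    i ∈ J.ofModulus (ENNReal.ofReal r) ↔ ‖J.eigenvalue i‖ = r := by
  simp only [JordanBlocks.ofModulus, Finset.mem_filter, Finset.mem_univ, true_and]
  rw [← ofReal_norm, ENNReal.ofReal_eq_ofReal_iff (norm_nonneg _) hr]

theorem IsJordanBasis.isOrbitReflexive_iff (hT : IsJordanBasis T J.eigenvalue b) (hr : 0 < r)
    (hμ : ∀ i, ‖J.eigenvalue i‖ ≤ r) (hex : ∃ i, ‖J.eigenvalue i‖ = r) :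
    IsOrbitReflexive T ↔ J.TwoLargestDifferByAtMostOne (ENNReal.ofReal r) := by
  have hmem := J.mem_ofModulus_ofReal hr.le
  constructor
  · intro h
    have hne : (J.ofModulus (ENNReal.ofReal r)).Nonempty := hex.imp fun i hi => (hmem i).2 hi
    obtain ⟨i, hi, hmax⟩ := Finset.exists_max_image _ J.size hne
    refine ⟨i, hi, hmax, ?_⟩
    by_contra! hlt
    obtain ⟨p, hp⟩ : ∃ p, J.size i = p + 2 := ⟨J.size i - 2, by omega⟩
    refine hT.not_isOrbitReflexive hr hμ ((hmem i).1 hi) hp (fun j hj hjr => ?_) h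
    have := Finset.le_sup (f := J.size) (Finset.mem_erase.2 ⟨hj, (hmem j).2 hjr⟩)
    omega
  · rintro ⟨i, hi, hmax, hsecond⟩
    obtain ⟨p, hp⟩ : ∃ p, J.size i = p + 1 := ⟨J.size i - 1, by have := J.size_pos i; omega⟩
    refine Set.Subset.antisymm (fun S hS => ?_) sotClosure_orb_subset_orbRef
    refine hT.mem_sotClosure_of_mem_orbRef hr hμ
      (fun j hj => hp ▸ hmax j ((hmem j).2 hj)) J.size_pos ((hmem i).1 hi) hp ?_ hS
    rcases ((J.ofModulus (ENNReal.ofReal r)).erase i).eq_empty_or_nonempty with he | hne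
    · rw [he, Finset.sup_empty, bot_eq_zero] at hsecond
      exact Or.inl (by omega)
    · obtain ⟨j, hj, hj'⟩ := Finset.exists_mem_eq_sup _ hne J.size
      rw [hj'] at hsecond
      rw [Finset.mem_erase, hmem] at hj
      exact Or.inr ⟨j, hj.1, hj.2, by omega⟩

end Equivalence

end COrbit

open Polynomial

namespace COrbit

/-! ### Cyclic modules over the polynomial ring. -/

section CyclicModule

theorem mk_pow_sub_C_eq_zero {μ : ℂ} {e k : ℕ} (h : e ≤ k) :
    (Submodule.Quotient.mk ((X - C μ) ^ k) :
      ℂ[X] ⧸ Submodule.span ℂ[X] {(X - C μ) ^ e}) = 0 := by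
  rw [Submodule.Quotient.mk_eq_zero]
  exact Ideal.mem_span_singleton.2 (pow_dvd_pow _ h)

/-- Taylor expansion at `μ`: powers of `X - C μ` from `e` on die in the quotient. -/
theorem span_mk_pow_sub_C (μ : ℂ) (e : ℕ) :
    ⊤ ≤ Submodule.span ℂ (Set.range fun k : Fin e =>
      (Submodule.Quotient.mk ((X - C μ) ^ (k : ℕ)) :
        ℂ[X] ⧸ Submodule.span ℂ[X] {(X - C μ) ^ e})) := by
  rintro x -
  obtain ⟨f, rfl⟩ := Submodule.Quotient.mk_surjective _ x
  rw [← sum_taylor_eq f μ, Polynomial.sum_def, ← Submodule.mkQ_apply, map_sum]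
  refine Submodule.sum_mem _ fun k _ => ?_
  rw [← smul_eq_C_mul, Submodule.mkQ_apply, Submodule.Quotient.mk_smul]
  refine Submodule.smul_mem _ _ ?_
  by_cases hk : k < e
  · exact Submodule.subset_span ⟨⟨k, hk⟩, rfl⟩
  · rw [mk_pow_sub_C_eq_zero (not_lt.1 hk)]
    exact Submodule.zero_mem _

theorem finrank_quotient_pow_sub_C (μ : ℂ) (e : ℕ) :
    Module.finrank ℂ (ℂ[X] ⧸ Submodule.span ℂ[X] {(X - C μ) ^ e}) = e := by
  have h := (AdjoinRoot.powerBasis' ((monic_X_sub_C μ).pow e)).finrank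
  rw [AdjoinRoot.powerBasis'_dim, natDegree_pow, natDegree_X_sub_C, mul_one] at h
  exact h

theorem exists_basis_quotient_pow_sub_C (μ : ℂ) (e : ℕ) :
    ∃ c : Module.Basis (Fin e) ℂ (ℂ[X] ⧸ Submodule.span ℂ[X] {(X - C μ) ^ e}),
      ∀ k : Fin e, (X : ℂ[X]) • c k =
        μ • c k + if h : (k : ℕ) + 1 < e then c ⟨k + 1, h⟩ else 0 := by
  refine ⟨basisOfTopLeSpanOfCardEqFinrank _ (span_mk_pow_sub_C μ e)
    (by rw [finrank_quotient_pow_sub_C, Fintype.card_fin]), fun k => ?_⟩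
  simp only [coe_basisOfTopLeSpanOfCardEqFinrank]
  have h1 : (X : ℂ[X]) • (X - C μ) ^ (k : ℕ) =
      μ • (X - C μ) ^ (k : ℕ) + (X - C μ) ^ ((k : ℕ) + 1) := by
    rw [smul_eq_C_mul, smul_eq_mul]; ring
  rw [← Submodule.Quotient.mk_smul, h1, Submodule.Quotient.mk_add, Submodule.Quotient.mk_smul]
  congr 1
  split_ifs with h
  · rfl
  · exact mk_pow_sub_C_eq_zero (not_lt.1 h)

theorem span_singleton_pow_eq_of_irreducible {p : ℂ[X]} (hp : Irreducible p) (e : ℕ) :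
    ∃ μ : ℂ, Submodule.span ℂ[X] {p ^ e} = Submodule.span ℂ[X] {(X - C μ) ^ e} := by
  obtain ⟨μ, hμ⟩ := IsAlgClosed.exists_root p
    (by rw [IsAlgClosed.degree_eq_one_of_irreducible ℂ hp]; exact one_ne_zero)
  refine ⟨μ, Ideal.span_singleton_eq_span_singleton.2 (Associated.pow_pow ?_)⟩
  exact ((irreducible_X_sub_C μ).associated_of_dvd hp (dvd_iff_isRoot.2 hμ)).symm

end CyclicModule

/-! ### Existence of Jordan forms, and Jordan bases from them. -/

section JordanForm

/-- The structure theorem may produce exponent `0`; such empty blocks are discarded and the rest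
renumbered. -/
theorem exists_basis_of_blocks {V : Type*} [AddCommGroup V] [Module ℂ V] (f : Module.End ℂ V)
    {ι : Type*} [Finite ι] (μ : ι → ℂ) (e : ι → ℕ) (B : Module.Basis (Σ i, Fin (e i)) ℂ V)
    (hB : ∀ i (k : Fin (e i)), f (B ⟨i, k⟩) = μ i • B ⟨i, k⟩ +
      if h : (k : ℕ) + 1 < e i then B ⟨i, ⟨k + 1, h⟩⟩ else 0) :
    ∃ (J : JordanBlocks) (B : Module.Basis (Σ i, Fin (J.size i)) ℂ V),
      ∀ i (k : Fin (J.size i)), f (B ⟨i, k⟩) = J.eigenvalue i • B ⟨i, k⟩ +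
        if h : (k : ℕ) + 1 < J.size i then B ⟨i, ⟨k + 1, h⟩⟩ else 0 := by
  obtain ⟨n, ⟨g⟩⟩ := Finite.exists_equiv_fin {i // 0 < e i}
  let J : JordanBlocks := ⟨n, fun j => μ (g.symm j), fun j => e (g.symm j),
    fun j => (g.symm j).2⟩
  let φ : (Σ j, Fin (J.size j)) → Σ i, Fin (e i) := fun a => ⟨g.symm a.1, a.2⟩
  have hφ : Function.Bijective φ := by
    constructor
    · rintro ⟨j, k⟩ ⟨j', k'⟩ h
      rw [Sigma.mk.injEq] at h
      obtain ⟨h1, h2⟩ := h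
      obtain rfl : j = j' := g.symm.injective (Subtype.ext h1)
      obtain rfl : k = k' := eq_of_heq h2
      rfl
    · rintro ⟨i, k⟩
      have hi : 0 < e i := (Nat.zero_le _).trans_lt k.2
      have hgi : g.symm (g ⟨i, hi⟩) = ⟨i, hi⟩ := g.symm_apply_apply _
      have hei : e (g.symm (g ⟨i, hi⟩)) = e i := by rw [hgi]
      refine ⟨⟨g ⟨i, hi⟩, ⟨k, by change _ < e _; rw [hei]; exact k.2⟩⟩, ?_⟩
      simp only [φ]
      rw [Sigma.mk.injEq]
      refine ⟨by rw [hgi], ?_⟩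
      exact (Fin.heq_ext_iff hei).2 rfl
  refine ⟨J, B.reindex (Equiv.ofBijective φ hφ).symm, fun j k => ?_⟩
  simp only [Module.Basis.reindex_apply, Equiv.symm_symm, Equiv.ofBijective_apply, φ]
  exact hB _ _

/-- With `X` acting as `f`, the space is a torsion module over a principal ideal domain. Its primary
cyclic summands are the blocks. -/
theorem exists_jordan_basis {V : Type*} [AddCommGroup V] [Module ℂ V] [FiniteDimensional ℂ V]
    (f : Module.End ℂ V) :
    ∃ (J : JordanBlocks) (B : Module.Basis (Σ i, Fin (J.size i)) ℂ V),
      ∀ i (k : Fin (J.size i)), f (B ⟨i, k⟩) = J.eigenvalue i • B ⟨i, k⟩ +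
        if h : (k : ℕ) + 1 < J.size i then B ⟨i, ⟨k + 1, h⟩⟩ else 0 := by
  classical
  obtain ⟨ι, _, p, hp, e, ⟨Φ⟩⟩ := Module.equiv_directSum_of_isTorsion
    (Module.AEval.isTorsion_of_finiteDimensional ℂ V f)
  choose μ hμ using fun i => span_singleton_pow_eq_of_irreducible (hp i) (e i)
  have hc : ∀ i, ∃ c : Module.Basis (Fin (e i)) ℂ (ℂ[X] ⧸ Submodule.span ℂ[X] {p i ^ e i}),
      ∀ k : Fin (e i), (X : ℂ[X]) • c k =
        μ i • c k + if h : (k : ℕ) + 1 < e i then c ⟨k + 1, h⟩ else 0 := by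
    intro i
    rw [hμ i]
    exact exists_basis_quotient_pow_sub_C (μ i) (e i)
  choose c hc using hc
  let Ψ : V ≃ₗ[ℂ] DirectSum ι fun i => ℂ[X] ⧸ Submodule.span ℂ[X] {p i ^ e i} :=
    (Module.AEval'.of f).trans (Φ.restrictScalars ℂ)
  have hΨ : ∀ v, Ψ (f v) = (X : ℂ[X]) • Ψ v := by
    intro v
    change Φ (Module.AEval'.of f (f v)) = (X : ℂ[X]) • Φ (Module.AEval'.of f v)
    rw [← Module.AEval'.X_smul_of, map_smul]
  let B : Module.Basis (Σ i, Fin (e i)) ℂ V := (DFinsupp.basis c).map Ψ.symm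
  have hB : ∀ i k, Ψ (B ⟨i, k⟩) = DirectSum.of _ i (c i k) := by
    intro i k
    simp only [B, Module.Basis.map_apply, LinearEquiv.apply_symm_apply]
    apply (DFinsupp.basis c).repr.injective
    rw [Module.Basis.repr_self]
    change Finsupp.single (⟨i, k⟩ : Σ i, Fin (e i)) (1 : ℂ) = sigmaFinsuppEquivDFinsupp.symm
      (DFinsupp.mapRange (fun i x => (c i).repr x) (fun _ => map_zero _) (DFinsupp.single i (c i k)))
    rw [Equiv.eq_symm_apply, sigmaFinsuppEquivDFinsupp_single, DFinsupp.mapRange_single,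
      Module.Basis.repr_self]
  refine exists_basis_of_blocks f μ e B fun i k => Ψ.injective ?_
  rw [hΨ, map_add, map_smul, hB]
  have h1 : (X : ℂ[X]) • DirectSum.of (fun i => ℂ[X] ⧸ Submodule.span ℂ[X] {p i ^ e i}) i (c i k)
      = DirectSum.of (fun i => ℂ[X] ⧸ Submodule.span ℂ[X] {p i ^ e i}) i ((X : ℂ[X]) • c i k) :=
    (DirectSum.of_smul _ _ _ _).symm
  have h2 : μ i • DirectSum.of (fun i => ℂ[X] ⧸ Submodule.span ℂ[X] {p i ^ e i}) i (c i k)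
      = DirectSum.of (fun i => ℂ[X] ⧸ Submodule.span ℂ[X] {p i ^ e i}) i (μ i • c i k) :=
    (DirectSum.of_smul _ _ _ _).symm
  rw [h1, h2, hc, map_add]
  congr 1
  split_ifs with h
  · rw [hB]
  · rw [map_zero, map_zero]

theorem JordanBlocks.toMatrix_mulVec_apply (J : JordanBlocks) (i : Fin J.numBlocks)
    (k : Fin (J.size i)) (v : (Σ i, Fin (J.size i)) → ℂ) :
    (J.toMatrix.mulVec v) ⟨i, k⟩ = ∑ l, jordanBlock (J.eigenvalue i) (J.size i) k l * v ⟨i, l⟩ := by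
  rw [Matrix.mulVec, dotProduct, Fintype.sum_sigma, Finset.sum_eq_single i]
  · simp only [JordanBlocks.toMatrix, Matrix.blockDiagonal'_apply_eq]
  · intro j _ hj
    refine Finset.sum_eq_zero fun l _ => ?_
    rw [JordanBlocks.toMatrix, Matrix.blockDiagonal'_apply_ne _ _ _ (Ne.symm hj), zero_mul]
  · simp

theorem sum_jordanBlock_mul (μ : ℂ) {m : ℕ} (k : Fin m) (w : Fin m → ℂ) :
    ∑ l, jordanBlock μ m k l * w l = μ * w k +
      if h : (k : ℕ) = 0 then 0 else w ⟨k - 1, by omega⟩ := by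
  have h1 : ∀ l, jordanBlock μ m k l * w l =
      (if k = l then μ * w l else 0) + (if (k : ℕ) = l + 1 then w l else 0) := by
    intro l
    simp only [jordanBlock, Matrix.of_apply]
    by_cases h : k = l
    · subst h; simp
    · by_cases h2 : (k : ℕ) = l + 1 <;> simp [h, h2]
  simp_rw [h1]
  rw [Finset.sum_add_distrib, Finset.sum_ite_eq]
  congr 1
  · simp
  split_ifs with h
  · exact Finset.sum_eq_zero fun l _ => if_neg (by omega)
  · rw [Finset.sum_eq_single ⟨k - 1, by omega⟩]
    · exact if_pos (by simp only; omega)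
    · intro l _ hl
      refine if_neg fun h2 => hl (Fin.ext ?_)
      simp only; omega
    · simp

theorem exists_isJordanForm {d : ℕ} (T : Matrix (Fin d) (Fin d) ℂ) :
    ∃ J : JordanBlocks, IsJordanForm T J := by
  classical
  obtain ⟨J, B, hB⟩ := exists_jordan_basis (Matrix.toLin' T)
  let e : Fin d ≃ Σ i, Fin (J.size i) := (Pi.basisFun ℂ (Fin d)).indexEquiv B
  let A := Pi.basisFun ℂ (Fin d)
  let B' := B.reindex e.symm
  have hJ : LinearMap.toMatrix B B (Matrix.toLin' T) = J.toMatrix := by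
    ext ⟨i, k⟩ ⟨j, l⟩
    rw [LinearMap.toMatrix_apply, hB]
    by_cases hij : i = j
    · subst hij
      rw [JordanBlocks.toMatrix, Matrix.blockDiagonal'_apply_eq, jordanBlock, Matrix.of_apply]
      rw [map_add, map_smul, Finsupp.add_apply, Finsupp.smul_apply, B.repr_self]
      by_cases hl : (l : ℕ) + 1 < J.size i
      · rw [dif_pos hl, B.repr_self]
        simp only [Finsupp.single_apply, Sigma.mk.injEq, heq_eq_eq, true_and, Fin.ext_iff]
        by_cases h1 : (k : ℕ) = l
        · simp [h1]
        · simp [h1, eq_comm]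
      · rw [dif_neg hl, map_zero]
        have : (k : ℕ) ≠ l + 1 := by omega
        simp [Finsupp.single_apply, this, eq_comm]
    · rw [JordanBlocks.toMatrix, Matrix.blockDiagonal'_apply_ne _ _ _ hij]
      rw [map_add, map_smul, Finsupp.add_apply, Finsupp.smul_apply, B.repr_self]
      split_ifs <;> simp [B.repr_self, Ne.symm hij]
  have hJ' : LinearMap.toMatrix B' B' (Matrix.toLin' T) = J.toMatrix.submatrix e e := by
    rw [← hJ]
    ext i j
    simp [LinearMap.toMatrix_apply, B']
  refine ⟨J, e, ⟨A.toMatrix B', B'.toMatrix A, A.toMatrix_mul_toMatrix_flip B',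
    B'.toMatrix_mul_toMatrix_flip A⟩, ?_⟩
  rw [← hJ']
  change T = A.toMatrix B' * LinearMap.toMatrix B' B' (Matrix.toLin' T) * B'.toMatrix A
  rw [basis_toMatrix_mul_linearMap_toMatrix_mul_basis_toMatrix]
  exact (LinearMap.toMatrix'_toLin' T).symm

/-- The coordinates are the entries of `P⁻¹ x`, renumbered by `e`; they intertwine `T` with the
block matrix. -/
theorem IsJordanForm.exists_isJordanBasis {d : ℕ} {T : Matrix (Fin d) (Fin d) ℂ}
    {J : JordanBlocks} (h : IsJordanForm T J) :
    ∃ b : Module.Basis (Σ i, Fin (J.size i)) ℂ (EuclideanSpace ℂ (Fin d)),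
      IsJordanBasis (Matrix.toEuclideanCLM (𝕜 := ℂ) T) J.eigenvalue b := by
  obtain ⟨e, P, hP⟩ := h
  have hPP : (P : Matrix (Fin d) (Fin d) ℂ) * ((P⁻¹ : GL (Fin d) ℂ) : Matrix (Fin d) (Fin d) ℂ)
      = 1 := Units.mul_inv P
  have hPP' : ((P⁻¹ : GL (Fin d) ℂ) : Matrix (Fin d) (Fin d) ℂ) * (P : Matrix (Fin d) (Fin d) ℂ)
      = 1 := Units.inv_mul P
  let Φ : EuclideanSpace ℂ (Fin d) ≃ₗ[ℂ] ((Σ i, Fin (J.size i)) → ℂ) :=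
    ((WithLp.linearEquiv 2 ℂ (Fin d → ℂ)).trans (Matrix.toLin'OfInv hPP hPP')).trans
      (LinearEquiv.funCongrLeft ℂ ℂ e.symm)
  have hΦ : ∀ x, Φ x =
      (((P⁻¹ : GL (Fin d) ℂ) : Matrix (Fin d) (Fin d) ℂ).mulVec (WithLp.ofLp x)) ∘ e.symm :=
    fun x => rfl
  have hΦT : ∀ x, Φ (Matrix.toEuclideanCLM (𝕜 := ℂ) T x) = J.toMatrix.mulVec (Φ x) := by
    intro x
    rw [hΦ, hΦ, Matrix.ofLp_toEuclideanCLM, Matrix.mulVec_mulVec]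
    have h1 : ((P⁻¹ : GL (Fin d) ℂ) : Matrix (Fin d) (Fin d) ℂ) * T =
        J.toMatrix.submatrix e e * ((P⁻¹ : GL (Fin d) ℂ) : Matrix (Fin d) (Fin d) ℂ) := by
      conv_lhs => rw [hP]
      rw [Matrix.mul_assoc, ← Matrix.mul_assoc, hPP', Matrix.one_mul]
    rw [h1, ← Matrix.mulVec_mulVec, Matrix.submatrix_mulVec_equiv, Function.comp_assoc,
      Equiv.self_comp_symm, Function.comp_id]
  refine ⟨Module.Basis.ofEquivFun Φ, fun x i k hk => ?_⟩
  have hrepr : ∀ x a, (Module.Basis.ofEquivFun Φ).repr x a = Φ x a := fun x a => rfl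
  rw [coord_apply _ hk, coord_apply _ hk, hrepr, hrepr, hΦT, J.toMatrix_mulVec_apply,
    sum_jordanBlock_mul _ _ (fun l => Φ x ⟨i, l⟩)]
  congr 1
  by_cases h0 : k = 0
  · simp [h0]
  · rw [if_neg h0, dif_neg h0, coord_apply _ (by omega : k - 1 < J.size i), hrepr]

end JordanForm

/-! ### Block eigenvalues and the spectral radius. -/

section SpectralRadius

/-- The first nonzero coordinate of an eigenvector in a block reads off the eigenvalue; conversely,
the last vector of a block is an eigenvector. -/
theorem IsJordanBasis.apply_eq_smul_iff {V : Type*} [NormedAddCommGroup V] [NormedSpace ℂ V]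
    {ι : Type*} [Finite ι] {s : ι → ℕ} {b : Module.Basis (Σ i, Fin (s i)) ℂ V} {T : V →L[ℂ] V}
    {μ : ι → ℂ} (hT : IsJordanBasis T μ b) (hs : ∀ i, 0 < s i) (z : ℂ) :
    (∃ x ≠ 0, T x = z • x) ↔ ∃ i, μ i = z := by
  classical
  constructor
  · rintro ⟨x, hx, hTx⟩
    obtain ⟨i, hi⟩ : ∃ i, ∃ k, k < s i ∧ coord b i k x ≠ 0 := by
      by_contra! h
      exact hx (ext_coord b fun i k hk => by rw [h i k hk, map_zero])
    refine ⟨i, ?_⟩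
    have hk := (Nat.find_spec hi).1
    have h1 := hT x i _ hk
    rw [hTx, map_smul, smul_eq_mul] at h1
    have h2 : (if Nat.find hi = 0 then 0 else coord b i (Nat.find hi - 1) x) = 0 := by
      split_ifs with h0
      · rfl
      · by_contra h3
        exact Nat.find_min hi (by omega : Nat.find hi - 1 < Nat.find hi) ⟨by omega, h3⟩
    rw [h2, add_zero] at h1
    exact (mul_right_cancel₀ (Nat.find_spec hi).2 h1).symm
  · rintro ⟨i, rfl⟩
    obtain ⟨p, hp⟩ : ∃ p, s i = p + 1 := ⟨s i - 1, by have := hs i; omega⟩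
    have hp' : p < s i := by omega
    exact ⟨vec b hp', b.ne_zero _, hT.apply_vec_last hp' hp⟩

theorem IsJordanBasis.isNilpotent {V : Type*} [NormedAddCommGroup V] [NormedSpace ℂ V]
    {ι : Type*} [Finite ι] {s : ι → ℕ} {b : Module.Basis (Σ i, Fin (s i)) ℂ V} {T : V →L[ℂ] V}
    {μ : ι → ℂ} (hT : IsJordanBasis T μ b) (hμ : ∀ i, μ i = 0) : IsNilpotent T := by
  obtain ⟨N, hN⟩ := (Set.finite_range s).bddAbove
  refine ⟨N, ?_⟩
  ext x
  refine ext_coord b fun i k hk => ?_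
  rw [hT.coord_pow x N hk, zero_apply, map_zero]
  refine Finset.sum_eq_zero fun q hq => ?_
  have h1 : s i ≤ N := hN ⟨i, rfl⟩
  rw [Finset.mem_range] at hq
  rw [hμ, zero_pow (by omega), mul_zero, zero_mul]

theorem mem_spectrum_iff_exists_toEuclideanCLM {d : ℕ} (T : Matrix (Fin d) (Fin d) ℂ) (z : ℂ) :
    z ∈ spectrum ℂ T ↔ ∃ x ≠ 0, Matrix.toEuclideanCLM (𝕜 := ℂ) T x = z • x := by
  rw [← Matrix.spectrum_toLin', ← Module.End.hasEigenvalue_iff_mem_spectrum]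
  constructor
  · intro h
    obtain ⟨v, hv⟩ := h.exists_hasEigenvector
    refine ⟨WithLp.toLp 2 v, by simpa using hv.2, ?_⟩
    rw [Matrix.toEuclideanCLM_toLp, ← Matrix.toLin'_apply, hv.apply_eq_smul, WithLp.toLp_smul]
  · rintro ⟨x, hx, hTx⟩
    refine Module.End.hasEigenvalue_of_hasEigenvector (x := WithLp.ofLp x)
      (Module.End.hasEigenvector_iff.2 ⟨?_, by simpa using hx⟩)
    rw [Module.End.mem_eigenspace_iff, Matrix.toLin'_apply, ← Matrix.ofLp_toEuclideanCLM, hTx,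
      WithLp.ofLp_smul]

theorem IsJordanForm.exists_spectralRadius_eq {d : ℕ} {T : Matrix (Fin d) (Fin d) ℂ}
    (hT : ¬ IsNilpotent T) {J : JordanBlocks} (h : IsJordanForm T J) :
    ∃ r : ℝ, 0 < r ∧ spectralRadius ℂ T = ENNReal.ofReal r ∧
      (∀ i, ‖J.eigenvalue i‖ ≤ r) ∧ ∃ i, ‖J.eigenvalue i‖ = r := by
  obtain ⟨b, hb⟩ := h.exists_isJordanBasis
  obtain ⟨i₁, hi₁⟩ : ∃ i, J.eigenvalue i ≠ 0 := by
    by_contra! h0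
    refine hT ?_
    have := (hb.isNilpotent h0).map (Matrix.toEuclideanCLM (𝕜 := ℂ) (n := Fin d)).symm
    simpa using this
  have : Nonempty (Fin J.numBlocks) := ⟨i₁⟩
  obtain ⟨i, hi⟩ := Finite.exists_max fun i => ‖J.eigenvalue i‖
  refine ⟨‖J.eigenvalue i‖, (norm_pos_iff.2 hi₁).trans_le (hi i₁), ?_, hi, i, rfl⟩
  have hspec : ∀ z, z ∈ spectrum ℂ T ↔ ∃ i, J.eigenvalue i = z := fun z =>
    (mem_spectrum_iff_exists_toEuclideanCLM T z).trans (hb.apply_eq_smul_iff J.size_pos z)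
  rw [ofReal_norm]
  refine le_antisymm (iSup₂_le fun z hz => ?_)
    (le_iSup₂_of_le (J.eigenvalue i) ((hspec _).2 ⟨i, rfl⟩) le_rfl)
  obtain ⟨j, rfl⟩ := (hspec z).1 hz
  exact ENNReal.coe_le_coe.2 (hi j)

end SpectralRadius

end COrbit

theorem mainTheorem1 (d : ℕ) (T : Matrix (Fin d) (Fin d) ℂ) (hT : ¬ IsNilpotent T) :
    0 < spectralRadius ℂ T ∧
    (∃ J : COrbit.JordanBlocks, COrbit.IsJordanForm T J) ∧
    ∀ J : COrbit.JordanBlocks, COrbit.IsJordanForm T J →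
      (COrbit.IsOrbitReflexive (Matrix.toEuclideanCLM (𝕜 := ℂ) T) ↔
        J.TwoLargestDifferByAtMostOne (spectralRadius ℂ T)) := by
  obtain ⟨J₀, hJ₀⟩ := COrbit.exists_isJordanForm T
  refine ⟨?_, ⟨J₀, hJ₀⟩, fun J hJ => ?_⟩
  · obtain ⟨r, hr, hrT, -⟩ := hJ₀.exists_spectralRadius_eq hT
    rw [hrT]
    exact ENNReal.ofReal_pos.2 hr
  · obtain ⟨r, hr, hrT, hle, hex⟩ := hJ.exists_spectralRadius_eq hT
    obtain ⟨b, hb⟩ := hJ.exists_isJordanBasis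
    rw [hrT]
    exact hb.isOrbitReflexive_iff J hr hle hex
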